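/- **Setting.** Let $V$ be a countable set, $F$ a finite set of spin values in an abelian group, and $\mathcal B$ a family of finite subsets of $V$ (hyperbonds) such that each vertex lies in finitely many of them. For $b\in\mathcal B$ let $\phi_b:F^b\to[-\infty,\infty)$ (the value $-\infty$ is a hard constraint), and assume that some $\omega\in F^V$ satisfies $\phi_b(\omega_b)>-\infty$ for all $b\in\mathcal B$. For finite $\Lambda\subset V$ and a boundary condition $\tilde\omega$, put $$\mu_{\Lambda,\tilde\omega}(\omega_\Lambda)=\frac1{Z_{\Lambda,\tilde\omega}}\exp\Big(\sum_{b\in\mathcal B:\,b\cap\Lambda\ne\emptyset}\phi_b\big((\omega_\Lambda\tilde\omega_{\Lambda^c})_b\big)\Big)\qquad\text{when } Z_{\Lambda,\tilde\omega}>0 .$$ $K_\phi$ is the set of Gibbs measures, i.e. of probability measures on $F^V$ that satisfy the DLR equations. $\delta\Lambda$ is the set of vertices lying in some $b\in\mathcal B$ that meets both $\Lambda$ and $\Lambda^c$. Call two distinct vertices adjacent if some hyperbond contains both. For a sum value $s$ let $F(s)=\{a\in F:\ s-a\in F\}$. The *non-overlap region* of $(\omega,\omega')$ is $\{i:|F(\omega_i+\omega'_i)|\neq1\}$;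 it contains the *disagreement set* $\{i:\omega_i\ne\omega'_i\}$, and equals it if (*) $\quad b+c=a+a$ with $a,b,c\in F$ implies $b=a$ (for instance if $F=\{-1,1\}\subset\mathbb R$). An infinite path of non-overlap (of disagreement) is an infinite self-avoiding path of successively adjacent vertices, all in the non-overlap region (in the disagreement set). For $\sigma$ on $\Lambda$ with values in $F+F$, let $\rho_{\Lambda,\tilde\omega}(\sigma)$ be the probability that two independent copies $\omega,\omega'$ with law $\mu_{\Lambda,\tilde\omega}$ have $\omega+\omega'=\sigma$, and let $\mu^\sigma_{\Lambda,\tilde\omega}$ be the conditional law of $\omega$ given this event, a law on $\Omega(\sigma)=\prod_{i\in\Lambda}F(\sigma_i)$. For $b$ meeting $\Lambda$ put $\Omega_b(\sigma)=\prod_{i\in b\cap\Lambda}F(\sigma_i)$. A random cluster representation (RCR) of $\mu^\sigma_{\Lambda,\tilde\omega}$ is a probability $\nu^\sigma$ on families $\eta=(\eta_b)_{b\cap\Lambda\neq\emptyset}$, $\eta_b\subseteq\Omega_b(\sigma)$, such that $\mu^\sigma_{\Lambda,\tilde\omega}(\omega)=\frac1{Z_1}\sum_\eta\nu^\sigma(\eta)\prod_b\mathbb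 I(\omega_{b\cap\Lambda}\in\eta_b)$ for $\omega\in\Omega(\sigma)$. $P^\sigma$ is the $\eta$-marginal of the joint law $\frac1{Z_1}\nu^\sigma(\eta)\prod_b\mathbb I(\omega_{b\cap\Lambda}\in\eta_b)$ on pairs $(\omega,\eta)$, $\omega\in\Omega(\sigma)$. A hyperbond $b$ is active if $\eta_b\ne\Omega_b(\sigma)$; two active hyperbonds are directly connected if they share a vertex $i\in\Lambda$ with $|F(\sigma_i)|\neq1$; and $S\leftrightarrow T$ means that a chain of successively directly connected active hyperbonds joins one meeting $S$ to one meeting $T$. **Condition (b)** for finite volumes $\Lambda(n)$ growing to $V$, boundary conditions $\tilde\omega(n)$ with $Z_{\Lambda(n),\tilde\omega(n)}>0$, and RCRs of the laws $\mu^\sigma_{\Lambda(n),\tilde\omega(n)}$: for all finite $\Lambda_0\subset V$ and $\epsilon>0$ there are finite $\Lambda_0\subseteq\Lambda_1\subseteq\Lambda_2$ such that, for every $n$ with $\Lambda(n)\supseteq\Lambda_2$, $$\rho_{\Lambda(n),\tilde\omega(n)}\big(\{\sigma:\ P^\sigma(\Lambda_0\leftrightarrow\delta\Lambda_1)\le\epsilon\}\big)\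 \ge\ 1-\epsilon .$$ **Lemma (disagreement percolation).** 1. If for all $\mu,\mu'\in K_\phi$ there is $\mu\times\mu'$-almost surely no infinite path of non-overlap, then condition (b) holds for all such sequences of volumes and boundary conditions and all choices of RCRs, and there is exactly one Gibbs measure. 2. If for all $\mu,\mu'\in K_\phi$ there is $\mu\times\mu'$-almost surely no infinite path of disagreement, then there is exactly one Gibbs measure; if moreover (*) holds, then condition (b) holds for all such sequences of volumes and boundary conditions and all choices of RCRs. -/

import Mathlib

open scoped Classical

namespace DisagreementPercolation

/-- A (possibly hard-core) interaction for spins in the finite alphabet `F`: a locally finite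
family of finite hyperbonds together with potentials on the hyperbonds. The Boltzmann factor is
`exp φ`, so the value `⊥` (that is, `-∞`) forbids a local configuration. -/
structure Interaction (V : Type*) {A : Type*} (F : Finset A) where
  bonds : Set (Finset V)
  locallyFinite : ∀ v : V, {b | b ∈ bonds ∧ v ∈ b}.Finite
  φ : (b : Finset V) → (b → F) → EReal
  φ_ne_top : ∀ b ∈ bonds, ∀ x, φ b x ≠ ⊤

/-- The configuration equal to `τ` on `Λ` and to `ω` off `Λ`. -/
noncomputable def glue {V S : Type*} (Λ : Finset V) (τ : Λ → S) (ω : V → S) : V → S :=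
  fun i => if h : i ∈ Λ then τ ⟨i, h⟩ else ω i

/-- There is an infinite self-avoiding path of `G` that stays in `D`. -/
def HasInfinitePath {V : Type*} (G : SimpleGraph V) (D : Set V) : Prop :=
  ∃ p : ℕ → V, Function.Injective p ∧ ∀ n, G.Adj (p n) (p (n + 1)) ∧ p n ∈ D

section Overlap

variable {V A : Type*} [AddCommGroup A] (F : Finset A)

/-- `F(s)`: the spin values `a` for which `a + b = s` for some spin value `b`. -/
noncomputable def fiber (s : A) : Finset A := F.filter fun a => ∃ b ∈ F, a + b = s

/-- The possible values of the sum of two spins. -/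
noncomputable def spinSums : Finset A := (F ×ˢ F).image fun p => p.1 + p.2

/-- `Σ`: the possible overlap configurations on `Λ`. -/
noncomputable def overlapConfigs (Λ : Finset V) : Finset (Λ → A) :=
  Fintype.piFinset fun _ => spinSums F

/-- `Ω(σ)`: the configurations on `Λ` that are compatible with `σ`. -/
noncomputable def compatConfigs (Λ : Finset V) (σ : Λ → A) : Finset (Λ → F) :=
  Finset.univ.filter fun ω => ∀ i, (ω i : A) ∈ fiber F (σ i)

/-- `Ω_b(σ)`: the local configurations on `b ∩ Λ` that are compatible with `σ`. -/
noncomputable def localCompat (Λ : Finset V) (σ : Λ → A) (b : Finset V) :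
    Finset (↥(b ∩ Λ) → F) :=
  Finset.univ.filter fun x =>
    ∀ i : ↥(b ∩ Λ), (x i : A) ∈ fiber F (σ ⟨i, (Finset.mem_inter.1 i.2).2⟩)

variable {F}

/-- The sites at which two configurations disagree. -/
def disagreement (ω ω' : V → F) : Set V := {i | ω i ≠ ω' i}

/-- The non-overlap region of two configurations: the sites at which the sum of the two spins
does not determine the two spins. -/
def nonOverlap (ω ω' : V → F) : Set V := {i | (fiber F ((ω i : A) + (ω' i : A))).card ≠ 1}

end Overlap

namespace Interaction

section Gibbs

variable {V A : Type*} {F : Finset A} (M : Interaction V F)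

/-- The hyperbonds that meet `Λ`. -/
noncomputable def touching (Λ : Finset V) : Finset (Finset V) :=
  Λ.biUnion fun v => (M.locallyFinite v).toFinset

theorem mem_touching {Λ b : Finset V} :
    b ∈ M.touching Λ ↔ b ∈ M.bonds ∧ (b ∩ Λ).Nonempty := by
  simp only [touching, Finset.mem_biUnion, Set.Finite.mem_toFinset, Set.mem_ofPred_eq,
    Finset.Nonempty, Finset.mem_inter]
  constructor
  · rintro ⟨v, hv, hb, hvb⟩
    exact ⟨hb, v, hvb, hv⟩
  · rintro ⟨hb, v, hvb, hv⟩
    exact ⟨v, hv, hb, hvb⟩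

/-- Two distinct sites are adjacent when some hyperbond contains both. -/
def graph : SimpleGraph V where
  Adj i j := i ≠ j ∧ ∃ b ∈ M.bonds, i ∈ b ∧ j ∈ b
  symm := ⟨fun _ _ h => ⟨h.1.symm, h.2.imp fun _ hb => ⟨hb.1, hb.2.2, hb.2.1⟩⟩⟩
  loopless := ⟨fun _ h => h.1 rfl⟩

/-- `δΛ`: the sites that lie in a hyperbond meeting both `Λ` and its complement. -/
def boundary (Λ : Finset V) : Set V :=
  {v | ∃ b ∈ M.bonds, v ∈ b ∧ (∃ i ∈ b, i ∈ Λ) ∧ ∃ j ∈ b, j ∉ Λ}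

/-- The Boltzmann weight in `Λ` with boundary condition `bc`. -/
noncomputable def weight (Λ : Finset V) (bc : V → F) (τ : Λ → F) : ℝ :=
  (EReal.exp (∑ b ∈ M.touching Λ, M.φ b fun i => glue Λ τ bc i)).toReal

/-- The partition function. -/
noncomputable def Z (Λ : Finset V) (bc : V → F) : ℝ := ∑ τ : Λ → F, M.weight Λ bc τ

/-- The finite volume Gibbs distribution (a probability exactly when `0 < Z`). -/
noncomputable def gibbs (Λ : Finset V) (bc : V → F) (τ : Λ → F) : ℝ :=
  M.weight Λ bc τ / M.Z Λ bc

/-- `μ` is an (infinite volume) Gibbs measure: it satisfies the DLR equations. -/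
def IsGibbs [MeasurableSpace A] (μ : MeasureTheory.Measure (V → F)) : Prop :=
  MeasureTheory.IsProbabilityMeasure μ ∧
  ∀ Λ : Finset V, (∀ᵐ ω ∂μ, 0 < M.Z Λ ω) ∧
    ∀ E : Set (V → F), MeasurableSet E →
      μ E = ∫⁻ ω, ∑ τ : Λ → F,
        ENNReal.ofReal (M.gibbs Λ ω τ) * E.indicator (fun _ => 1) (glue Λ τ ω) ∂μ

/-- Configurations of hyperbond variables in `Λ`: to every hyperbond `b` meeting `Λ`, a set of
configurations on `b ∩ Λ` (the spins of `b` outside `Λ` are frozen by the boundary condition). -/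
abbrev HyperConfig (Λ : Finset V) : Type _ :=
  (b : ↥(M.touching Λ)) → Finset (↥((b : Finset V) ∩ Λ) → F)

/-- `ω ∼ η`: the restriction of `ω` to every hyperbond `b` belongs to `η b`. -/
def Compatible {Λ : Finset V} (ω : Λ → F) (η : M.HyperConfig Λ) : Prop :=
  ∀ b : ↥(M.touching Λ),
    (fun i : ↥((b : Finset V) ∩ Λ) => ω ⟨i, (Finset.mem_inter.1 i.2).2⟩) ∈ η b

end Gibbs

section RandomCluster

variable {V A : Type*} [AddCommGroup A] {F : Finset A} (M : Interaction V F)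

/-- The overlap configuration distribution `ρ` of two independent copies. -/
noncomputable def overlapDist (Λ : Finset V) (bc : V → F) (σ : Λ → A) : ℝ :=
  ∑ ω : Λ → F, ∑ ω' : Λ → F,
    if ∀ i, (ω i : A) + (ω' i : A) = σ i then M.gibbs Λ bc ω * M.gibbs Λ bc ω' else 0

/-- The non-overlap configuration distribution `μ^σ`: the law of the first copy given that the
sum of the two independent copies is `σ` (meaningful when `σ` has positive probability). -/
noncomputable def nonOverlapDist (Λ : Finset V) (bc : V → F) (σ : Λ → A) (ω : Λ → F) : ℝ :=
  (∑ ω' : Λ → F,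
    if ∀ i, (ω i : A) + (ω' i : A) = σ i then M.gibbs Λ bc ω * M.gibbs Λ bc ω' else 0)
    / M.overlapDist Λ bc σ

/-- The number of configurations in `Ω(σ)` compatible with `η`. -/
noncomputable def numCompat {Λ : Finset V} (σ : Λ → A) (η : M.HyperConfig Λ) : ℕ :=
  ((compatConfigs F Λ σ).filter fun ω => M.Compatible ω η).card

/-- The normalizing factor of a random cluster representation with base `ν`. -/
noncomputable def rcrZ {Λ : Finset V} (σ : Λ → A) (ν : M.HyperConfig Λ → ℝ) : ℝ :=
  ∑ η, ν η * M.numCompat σ η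

/-- `ν` is the base of a random cluster representation of the distribution `m` on `Ω(σ)`. -/
def IsRCR {Λ : Finset V} (σ : Λ → A) (m : (Λ → F) → ℝ) (ν : M.HyperConfig Λ → ℝ) : Prop :=
  (∀ η, 0 ≤ ν η) ∧ (∑ η, ν η = 1) ∧
  (∀ η, ν η ≠ 0 → ∀ b, η b ⊆ localCompat F Λ σ b) ∧
  ∀ ω ∈ compatConfigs F Λ σ,
    m ω = (∑ η, if M.Compatible ω η then ν η else 0) / M.rcrZ σ ν

/-- The random cluster probability of the event `C`: the marginal on the hyperbond variables of
the joint law proportional to `ν η * 1(ω ∼ η)`, `ω ∈ Ω(σ)`. -/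
noncomputable def rcrProb {Λ : Finset V} (σ : Λ → A) (ν : M.HyperConfig Λ → ℝ)
    (C : M.HyperConfig Λ → Prop) : ℝ :=
  (∑ η, if C η then ν η * M.numCompat σ η else 0) / M.rcrZ σ ν

/-- A hyperbond is active when it excludes some local configuration compatible with `σ`. -/
def Active {Λ : Finset V} (σ : Λ → A) (η : M.HyperConfig Λ) (b : ↥(M.touching Λ)) : Prop :=
  η b ≠ localCompat F Λ σ b

/-- Two active hyperbonds are directly connected when they share a site of the non-overlap
region of `σ`. -/
def DirectlyConnected {Λ : Finset V} (σ : Λ → A) (η : M.HyperConfig Λ)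
    (b c : ↥(M.touching Λ)) : Prop :=
  M.Active σ η b ∧ M.Active σ η c ∧
    ∃ i : Λ, (i : V) ∈ (b : Finset V) ∧ (i : V) ∈ (c : Finset V) ∧ (fiber F (σ i)).card ≠ 1

/-- A chain of sequentially directly connected active hyperbonds joins `S` to `T`. -/
def ActConnected {Λ : Finset V} (σ : Λ → A) (S T : Set V) (η : M.HyperConfig Λ) : Prop :=
  ∃ b c : ↥(M.touching Λ), M.Active σ η b ∧ M.Active σ η c ∧
    (∃ i ∈ (b : Finset V), i ∈ S) ∧ (∃ j ∈ (c : Finset V), j ∈ T) ∧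
    Relation.ReflTransGen (M.DirectlyConnected σ η) b c

/-- The condition that active connectivity in the non-overlap distributions vanishes, for the
sequence of volumes `Λ`, boundary conditions `bc` and random cluster bases `ν n σ`:
for every finite `Λ₀` and `ε > 0` there are `Λ₀ ⊆ Λ₁ ⊆ Λ₂` such that, in all volumes of the
sequence containing `Λ₂`, with `ρ`-probability at least `1 - ε` the overlap configuration `σ` is
such that `P^σ(Λ₀ ↔ δΛ₁) ≤ ε`. -/
def ConditionB (Λ : ℕ → Finset V) (bc : ℕ → V → F)
    (ν : ∀ n, (Λ n → A) → M.HyperConfig (Λ n) → ℝ) : Prop :=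
  ∀ (Λ₀ : Finset V) (ε : ℝ), 0 < ε → ∃ Λ₁ Λ₂ : Finset V, Λ₀ ⊆ Λ₁ ∧ Λ₁ ⊆ Λ₂ ∧
    ∀ n, Λ₂ ⊆ Λ n →
      1 - ε ≤ ∑ σ ∈ overlapConfigs F (Λ n),
        if M.rcrProb σ (ν n σ) (M.ActConnected σ (Λ₀ : Set V) (M.boundary Λ₁)) ≤ ε
          then M.overlapDist (Λ n) (bc n) σ else 0

/-- `ConditionB` for all sequences of boundary conditions with well defined finite volume Gibbs
distributions along volumes growing to `V`, whatever random cluster representations of the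
non-overlap distributions are used. -/
def ConditionBForAll : Prop :=
  ∀ (Λ : ℕ → Finset V) (bc : ℕ → V → F)
    (ν : ∀ n, (Λ n → A) → M.HyperConfig (Λ n) → ℝ),
    Filter.Tendsto Λ Filter.atTop Filter.atTop →
    (∀ n, 0 < M.Z (Λ n) (bc n)) →
    (∀ n, ∀ σ ∈ overlapConfigs F (Λ n), 0 < M.overlapDist (Λ n) (bc n) σ →
      M.IsRCR σ (M.nonOverlapDist (Λ n) (bc n) σ) (ν n σ)) →
    M.ConditionB Λ bc ν

end RandomCluster

end Interaction

end DisagreementPercolation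

/-!
The first observation behind the vanishing of active connectivity is deterministic: consecutive
hyperbonds of an active chain share a site of the non-overlap region, so if `P^σ(Λ₀ ↔ δΛ₁)` is
positive for any choice of random cluster representation, then the overlap configuration `σ` itself
contains a path of non-overlap from the vicinity of `Λ₀` to that of `δΛ₁`
(`ActConnected.hasPath`). With `Λ₁` a large ball around `Λ₀`, such a path contains a self-avoiding
path with `k` steps started next to `Λ₀`, which is an event depending on finitely many spins of the
two copies. If `ConditionB` failed, one could choose for every `k` a volume in which this event
has probability more than `ε`. The configuration space is compact, and the finite volume Gibbs
distributions are consistent (`kern_bind_kern`) and local, so these finite volume measures have a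
limit point `μ` that is a Gibbs measure (`exists_isGibbs_tendsto`). Under `μ × μ` all the path
events have probability at least `ε`, hence so has their intersection, which by König's lemma
(`hasInfinitePath_of_forall_hasPath`) consists of pairs with an infinite path of non-overlap. The
same compactness argument with an admissible boundary condition shows that Gibbs measures exist.

Uniqueness is disagreement percolation. Given Gibbs measures `μ` and `μ'`, explore, for a pair with
law `μ × μ'`, the clusters of disagreement that reach a large ball `Λ` from outside, and let `Γ` be
the set of sites that are neither explored nor adjacent to an explored site (`sheltered`). Whether
`Γ = G` is decided by the spins outside `G`, and on this event the two configurations agree on all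
sites outside `G` that interact with `G`. Conditionally on it, both copies therefore have the same
law in `G` (`prod_shelterEvent_inter`). Without an infinite path of disagreement, `Γ` contains any
given finite set with probability tending to one as `Λ` grows, so `μ = μ'`. Since sites of
disagreement are sites of non-overlap, this also covers the non-overlap hypothesis, and the
two regions coincide when `b + c = a + a` forces `b = a` (`nonOverlap_eq_disagreement`).
-/

namespace DisagreementPercolation

/-! ### Self-avoiding paths -/

/-- There is a self-avoiding path of `G` with `k` steps that starts in `S` and stays in `D`. -/
def HasPath {V : Type*} (G : SimpleGraph V) (D S : Set V) (k : ℕ) : Prop :=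
  ∃ p : Fin (k + 1) → V, Function.Injective p ∧ p 0 ∈ S ∧
    (∀ i : Fin k, G.Adj (p i.castSucc) (p i.succ)) ∧ ∀ i, p i ∈ D

section Paths

variable {V : Type*} {G : SimpleGraph V} {D S : Set V}

theorem HasPath.mono_length {j k : ℕ} (hjk : j ≤ k) (h : HasPath G D S k) :
    HasPath G D S j := by
  obtain ⟨p, hp, h0, ha, hD⟩ := h
  refine ⟨fun i => p (Fin.castLE (by omega) i), fun a b hab => ?_, h0, fun i => ?_, fun i => hD _⟩
  · simpa using hp hab
  · exact ha (Fin.castLE hjk i)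

theorem HasInfinitePath.mono {D' : Set V} (h : D ⊆ D') (hp : HasInfinitePath G D) :
    HasInfinitePath G D' := by
  obtain ⟨p, hi, hp⟩ := hp
  exact ⟨p, hi, fun n => ⟨(hp n).1, h (hp n).2⟩⟩

/-- König's lemma for self-avoiding paths in a locally finite graph. -/
theorem hasInfinitePath_of_forall_hasPath (hG : ∀ v, (G.neighborSet v).Finite) (hS : S.Finite)
    (h : ∀ k, HasPath G D S k) : HasInfinitePath G D := by
  let α : ℕ → Type _ := fun k => {p : Fin (k + 1) → V // Function.Injective p ∧ p 0 ∈ S ∧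
    (∀ i : Fin k, G.Adj (p i.castSucc) (p i.succ)) ∧ ∀ i, p i ∈ D}
  let π : {i j : ℕ} → i ≤ j → α j → α i := fun {i j} hij p =>
    ⟨fun l => p.1 (Fin.castLE (by omega) l),
      fun a b hab => by simpa using p.2.1 hab, p.2.2.1,
      fun l => p.2.2.2.1 (Fin.castLE hij l), fun l => p.2.2.2.2 _⟩
  have hne : ∀ i, Nonempty (α i) := fun i => by
    obtain ⟨p, hp⟩ := h i
    exact ⟨⟨p, hp⟩⟩
  have hfin0 : Finite (α 0) := by
    have := hS.to_subtype
    refine Finite.of_injective (fun p : α 0 => (⟨p.1 0, p.2.2.1⟩ : S)) fun p q hpq => ?_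
    apply Subtype.ext
    funext i
    rw [Subsingleton.elim (α := Fin 1) i 0]
    exact congrArg Subtype.val hpq
  obtain ⟨f, hf⟩ := exists_seq_forall_proj_of_forall_finite π (fun i a => rfl)
    (fun i j k hij hjk a => rfl) (fun i a => by
      refine Set.Finite.of_finite_image (f := fun b : α (i + 1) => b.1 (Fin.last _))
        ((hG (a.1 (Fin.last _))).subset ?_) ?_
      · rintro _ ⟨b, hb, rfl⟩
        have hb' : π (Nat.le_add_right i 1) b = a := hb
        rw [← hb']
        exact b.2.2.2.1 (Fin.last i)
      · intro b hb c hc hbc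
        have hbc' : π (Nat.le_add_right i 1) b = π (Nat.le_add_right i 1) c := hb.trans hc.symm
        apply Subtype.ext
        funext l
        induction l using Fin.lastCases with
        | last => exact hbc
        | cast l => exact congrFun (congrArg Subtype.val hbc') l)
  have key : ∀ {m n : ℕ} (hmn : m ≤ n),
      (f m).1 (Fin.last m) = (f n).1 ⟨m, by omega⟩ := fun {m n} hmn =>
    (congrFun (congrArg Subtype.val (hf hmn)) (Fin.last m)).symm
  refine ⟨fun n => (f n).1 (Fin.last n), fun m n hmn => ?_, fun n => ⟨?_, (f n).2.2.2.2 _⟩⟩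
  · have hmn' : (f m).1 (Fin.last m) = (f n).1 (Fin.last n) := hmn
    rw [key (le_max_left m n), key (le_max_right m n)] at hmn'
    simpa using (f (max m n)).2.1 hmn'
  · show G.Adj ((f n).1 (Fin.last n)) ((f (n + 1)).1 (Fin.last (n + 1)))
    rw [key (Nat.le_succ n)]
    exact (f (n + 1)).2.2.2.1 (Fin.last n)

/-- The subgraph of the edges of `G` with both ends in `D`. -/
def edgesIn (G : SimpleGraph V) (D : Set V) : SimpleGraph V where
  Adj u v := G.Adj u v ∧ u ∈ D ∧ v ∈ D
  symm := ⟨fun _ _ h => ⟨h.1.symm, h.2.2, h.2.1⟩⟩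
  loopless := ⟨fun _ h => G.loopless.irrefl _ h.1⟩

end Paths

/-! ### Neighbourhoods and the exploration from outside -/

namespace Interaction

variable {V A : Type*} {F : Finset A} (M : Interaction V F)

/-- The union of `B` with all hyperbonds that meet `B`. -/
noncomputable def nbhd (B : Finset V) : Finset V := B ∪ (M.touching B).biUnion id

variable {M}

theorem mem_nbhd {B : Finset V} {v : V} :
    v ∈ M.nbhd B ↔ v ∈ B ∨ ∃ b ∈ M.bonds, v ∈ b ∧ ∃ u ∈ B, u ∈ b := by
  simp only [nbhd, Finset.mem_union, Finset.mem_biUnion, mem_touching, id, Finset.Nonempty,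
    Finset.mem_inter]
  constructor
  · rintro (h | ⟨b, ⟨hb, u, hu, huB⟩, hv⟩)
    · exact Or.inl h
    · exact Or.inr ⟨b, hb, hv, u, huB, hu⟩
  · rintro (h | ⟨b, hb, hv, u, huB, hu⟩)
    · exact Or.inl h
    · exact Or.inr ⟨b, ⟨hb, u, hu, huB⟩, hv⟩

theorem subset_nbhd (B : Finset V) : B ⊆ M.nbhd B := fun _ h => mem_nbhd.2 (Or.inl h)

theorem mem_nbhd_of_adj {B : Finset V} {u v : V} (hu : u ∈ B) (h : M.graph.Adj u v) :
    v ∈ M.nbhd B := by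
  obtain ⟨-, b, hb, hub, hvb⟩ := h
  exact mem_nbhd.2 (Or.inr ⟨b, hb, hvb, u, hu, hub⟩)

theorem subset_nbhd_of_mem_touching {B b : Finset V} (h : b ∈ M.touching B) : b ⊆ M.nbhd B :=
  (Finset.subset_biUnion_of_mem id h).trans Finset.subset_union_right

theorem monotone_iterate_nbhd (B : Finset V) : Monotone fun k => M.nbhd^[k] B :=
  monotone_nat_of_le_succ fun k => by
    rw [Function.iterate_succ_apply']
    exact subset_nbhd _

variable (M) in
theorem finite_neighborSet (v : V) : (M.graph.neighborSet v).Finite :=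
  (M.nbhd {v}).finite_toSet.subset fun _ hu => mem_nbhd_of_adj (Finset.mem_singleton_self v) hu

theorem notMem_of_mem_boundary_nbhd {B : Finset V} {v : V} (h : v ∈ M.boundary (M.nbhd B)) :
    v ∉ B := by
  obtain ⟨b, hb, hvb, -, j, hj, hjn⟩ := h
  exact fun hv => hjn (mem_nbhd.2 (Or.inr ⟨b, hb, hj, v, hv, hvb⟩))

/-- The `i`-th vertex of a path started in `S` is within `i` steps of `S`, so that the existence
of a path with `k` steps is a local property of the region. -/
theorem hasPath_congr {D D' : Set V} {S : Finset V} {k : ℕ}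
    (h : ∀ v ∈ M.nbhd^[k] S, v ∈ D → v ∈ D') (hp : HasPath M.graph D S k) :
    HasPath M.graph D' S k := by
  obtain ⟨p, hi, h0, ha, hD⟩ := hp
  have hmem : ∀ i : Fin (k + 1), p i ∈ M.nbhd^[(i : ℕ)] S := by
    intro i
    induction i using Fin.induction with
    | zero => exact h0
    | succ i ih =>
      rw [Fin.val_succ, Function.iterate_succ_apply']
      exact mem_nbhd_of_adj ih (ha i)
  exact ⟨p, hi, h0, ha, fun i =>
    h _ (monotone_iterate_nbhd S (Nat.lt_succ_iff.1 i.2) (hmem i)) (hD i)⟩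

/-- A connection inside `D` from `S` to a far away vertex contains a long self-avoiding path. -/
theorem hasPath_of_reachable {D : Set V} {S : Finset V} {k : ℕ} {u v : V} (hu : u ∈ S)
    (huv : (edgesIn M.graph D).Reachable u v) (hv : v ∉ M.nbhd^[k] S) :
    HasPath M.graph D S k := by
  obtain ⟨p, hp⟩ := huv.exists_isPath
  have hmem : ∀ i ≤ p.length, p.getVert i ∈ M.nbhd^[i] S := by
    intro i
    induction i with
    | zero => intro _; simpa using hu
    | succ i ih =>
      intro hi
      rw [Function.iterate_succ_apply']
      exact mem_nbhd_of_adj (ih (by omega)) (p.adj_getVert_succ (by omega)).1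
  have hk : k < p.length := by
    by_contra! hk
    apply hv
    have := hmem _ le_rfl
    rw [p.getVert_length] at this
    exact monotone_iterate_nbhd S hk this
  refine ⟨fun i => p.getVert i, fun i j hij => ?_, by simpa using hu, fun i => ?_, fun i => ?_⟩
  · exact Fin.ext (hp.getVert_injOn (by simp; omega) (by simp; omega) hij)
  · exact (p.adj_getVert_succ (i := i) (by omega)).1
  · exact (p.adj_getVert_succ (i := i) (by omega)).2.1

variable (M) in
/-- The sites explored from outside `Λ`: the complement of `Λ` and the sites joined to it by a
path in `D`. -/
def explored (Λ : Finset V) (D : Set V) : Set V :=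
  {v | ∃ w ∉ Λ, Relation.ReflTransGen (fun u v => M.graph.Adj u v ∧ v ∈ D) w v}

variable (M) in
/-- The sites of `Λ` that are neither explored from outside nor adjacent to an explored site. -/
noncomputable def sheltered (Λ : Finset V) (D : Set V) : Finset V :=
  Λ.filter fun v => v ∉ M.explored Λ D ∧ ∀ u ∈ M.explored Λ D, ¬ M.graph.Adj u v

theorem explored_of_notMem {Λ : Finset V} {D : Set V} {v : V} (h : v ∉ Λ) :
    v ∈ M.explored Λ D := ⟨v, h, .refl⟩

theorem explored_of_adj {Λ : Finset V} {D : Set V} {u v : V} (hu : u ∈ M.explored Λ D)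
    (h : M.graph.Adj u v) (hv : v ∈ D) : v ∈ M.explored Λ D := by
  obtain ⟨w, hw, hwu⟩ := hu
  exact ⟨w, hw, hwu.tail ⟨h, hv⟩⟩

theorem explored_subset {Λ : Finset V} {D R : Set V} (h₀ : ∀ v ∉ Λ, v ∈ R)
    (h : ∀ u ∈ M.explored Λ D, u ∈ R → ∀ v ∈ D, M.graph.Adj u v → v ∈ R) :
    M.explored Λ D ⊆ R := by
  rintro v ⟨w, hw, hwv⟩
  induction hwv with
  | refl => exact h₀ _ hw
  | @tail b c hb hc ih => exact h b ⟨w, hw, hb⟩ ih c hc.2 hc.1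

theorem sheltered_subset (Λ : Finset V) (D : Set V) : M.sheltered Λ D ⊆ Λ :=
  Finset.filter_subset _ _

theorem mem_sheltered {Λ : Finset V} {D : Set V} {v : V} :
    v ∈ M.sheltered Λ D ↔
      v ∉ M.explored Λ D ∧ ∀ u ∈ M.explored Λ D, ¬ M.graph.Adj u v := by
  simp only [sheltered, Finset.mem_filter, and_iff_right_iff_imp]
  rintro ⟨h, -⟩
  by_contra hv
  exact h (explored_of_notMem hv)

/-- The exploration from outside never inspects the sheltered sites. -/
theorem sheltered_congr {Λ : Finset V} {D D' : Set V}
    (h : ∀ v ∈ Λ, v ∉ M.sheltered Λ D → (v ∈ D ↔ v ∈ D')) :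
    M.sheltered Λ D' = M.sheltered Λ D := by
  have h₁ : M.explored Λ D' ⊆ M.explored Λ D := by
    refine explored_subset (fun v hv => explored_of_notMem hv) fun u _ hu v hv huv => ?_
    by_cases hvΛ : v ∈ Λ
    · exact explored_of_adj hu huv
        ((h v hvΛ fun hs => (mem_sheltered.1 hs).2 u hu huv).2 hv)
    · exact explored_of_notMem hvΛ
  have h₂ : M.explored Λ D ⊆ M.explored Λ D' := by
    refine explored_subset (fun v hv => explored_of_notMem hv) fun u hu hu' v hv huv => ?_
    by_cases hvΛ : v ∈ Λ
    · exact explored_of_adj hu' huv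
        ((h v hvΛ fun hs => (mem_sheltered.1 hs).2 u hu huv).1 hv)
    · exact explored_of_notMem hvΛ
  simp only [sheltered, h₁.antisymm h₂]

/-- The hyperbonds that meet the sheltered region meet `D` only in the sheltered region. -/
theorem notMem_of_mem_nbhd_sheltered {Λ : Finset V} {D : Set V} {v : V}
    (hv : v ∈ M.nbhd (M.sheltered Λ D)) (hv' : v ∉ M.sheltered Λ D) : v ∉ D := by
  rcases mem_nbhd.1 hv with h | ⟨b, hb, hvb, u, hu, hub⟩
  · exact absurd h hv'
  have huv : u ≠ v := fun h => hv' (h ▸ hu)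
  have hadj : M.graph.Adj v u := ⟨huv.symm, b, hb, hvb, hub⟩
  have hve : v ∉ M.explored Λ D := fun h => (mem_sheltered.1 hu).2 v h hadj
  intro hD
  refine hv' (mem_sheltered.2 ⟨hve, fun w hw hwv => hve (explored_of_adj hw hwv hD)⟩)

/-- If `B` is not sheltered inside a large volume then a long path starts near `B`. -/
theorem hasPath_of_not_subset_sheltered {B : Finset V} {D : Set V} {k : ℕ}
    (h : ¬ B ⊆ M.sheltered (M.nbhd^[k + 2] B) D) : HasPath M.graph D (M.nbhd B) k := by
  obtain ⟨v, hvB, hv⟩ := Finset.not_subset.1 h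
  have hex : ∃ u ∈ M.nbhd B, u ∈ M.explored (M.nbhd^[k + 2] B) D := by
    rw [mem_sheltered, not_and_or] at hv
    rcases hv with hv | hv
    · exact ⟨v, subset_nbhd B hvB, not_not.1 hv⟩
    · push Not at hv
      obtain ⟨u, hu, huv⟩ := hv
      exact ⟨u, mem_nbhd_of_adj hvB huv.symm, hu⟩
  obtain ⟨u, hu, w, hw, hwu⟩ := hex
  -- Peel off the first step, since the starting point `w` need not lie in `D`.
  rcases hwu.cases_head with rfl | ⟨x, ⟨hwx, hx⟩, hxu⟩
  · exact absurd (monotone_iterate_nbhd B (show 1 ≤ k + 2 by omega) hu) hw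
  have hxk : x ∉ M.nbhd^[k + 1] B := by
    intro hx'
    apply hw
    rw [Function.iterate_succ_apply']
    exact mem_nbhd_of_adj hx' hwx.symm
  refine hasPath_of_reachable hu (SimpleGraph.Reachable.symm (u := x) ?_)
    (by rwa [← Function.iterate_succ_apply])
  have hgen : ∀ y, Relation.ReflTransGen (fun u v => M.graph.Adj u v ∧ v ∈ D) x y →
      y ∈ D ∧ (edgesIn M.graph D).Reachable x y := by
    intro y hy
    induction hy with
    | refl => exact ⟨hx, .refl _⟩
    | tail _ hbc ih =>
      exact ⟨hbc.2, ih.2.trans (SimpleGraph.Adj.reachable ⟨hbc.1, ih.1, hbc.2⟩)⟩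
  exact (hgen u hxu).2

end Interaction

end DisagreementPercolation

namespace DisagreementPercolation

open MeasureTheory

/-! ### Finite volume Gibbs measures -/

theorem glue_of_mem {V S : Type*} {Λ : Finset V} {τ : Λ → S} {ω : V → S} {i : V} (h : i ∈ Λ) :
    glue Λ τ ω i = τ ⟨i, h⟩ := dif_pos h

theorem glue_of_notMem {V S : Type*} {Λ : Finset V} {τ : Λ → S} {ω : V → S} {i : V}
    (h : i ∉ Λ) : glue Λ τ ω i = ω i := dif_neg h

theorem glue_restrict {V S : Type*} {Λ : Finset V} (ω : V → S) :
    glue Λ (fun i => ω i) ω = ω := by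
  funext i
  by_cases hi : i ∈ Λ
  · simp only [glue_of_mem hi]
  · simp only [glue_of_notMem hi]

namespace Interaction

variable {V A : Type*} {F : Finset A} (M : Interaction V F)

/-- The product of the Boltzmann factors of the hyperbonds in `B`. -/
noncomputable def boltzmann (B : Finset (Finset V)) (ω : V → F) : ℝ :=
  ∏ b ∈ B, (EReal.exp (M.φ b fun i => ω i)).toReal

theorem boltzmann_nonneg (B : Finset (Finset V)) (ω : V → F) : 0 ≤ M.boltzmann B ω :=
  Finset.prod_nonneg fun _ _ => ENNReal.toReal_nonneg

theorem boltzmann_congr {B : Finset (Finset V)} {ω ω' : V → F}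
    (h : ∀ b ∈ B, ∀ i ∈ b, ω i = ω' i) : M.boltzmann B ω = M.boltzmann B ω' :=
  Finset.prod_congr rfl fun b hb => by
    rw [show (fun i : b => ω i) = fun i : b => ω' i from funext fun i => h b hb i i.2]

theorem exp_sum (B : Finset (Finset V)) (f : Finset V → EReal) :
    EReal.exp (∑ b ∈ B, f b) = ∏ b ∈ B, EReal.exp (f b) := by
  induction B using Finset.induction_on with
  | empty => simp
  | insert b B hb ih => rw [Finset.sum_insert hb, Finset.prod_insert hb, EReal.exp_add, ih]

theorem weight_eq (Λ : Finset V) (bc : V → F) (τ : Λ → F) :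
    M.weight Λ bc τ = M.boltzmann (M.touching Λ) (glue Λ τ bc) := by
  rw [weight, exp_sum, ENNReal.toReal_prod, boltzmann]

theorem weight_nonneg (Λ : Finset V) (bc : V → F) (τ : Λ → F) : 0 ≤ M.weight Λ bc τ :=
  ENNReal.toReal_nonneg

theorem Z_nonneg (Λ : Finset V) (bc : V → F) : 0 ≤ M.Z Λ bc :=
  Finset.sum_nonneg fun _ _ => M.weight_nonneg _ _ _

theorem weight_le_Z (Λ : Finset V) (bc : V → F) (τ : Λ → F) : M.weight Λ bc τ ≤ M.Z Λ bc :=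
  Finset.single_le_sum (f := M.weight Λ bc) (fun _ _ => M.weight_nonneg _ _ _)
    (Finset.mem_univ τ)

theorem gibbs_nonneg (Λ : Finset V) (bc : V → F) (τ : Λ → F) : 0 ≤ M.gibbs Λ bc τ :=
  div_nonneg (M.weight_nonneg _ _ _) (M.Z_nonneg _ _)

theorem sum_gibbs {Λ : Finset V} {bc : V → F} (h : 0 < M.Z Λ bc) :
    ∑ τ, M.gibbs Λ bc τ = 1 := by
  simp only [gibbs]
  rw [← Finset.sum_div]
  exact div_self h.ne'

theorem gibbs_eq_zero {Λ : Finset V} {bc : V → F} (h : ¬ 0 < M.Z Λ bc) (τ : Λ → F) :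
    M.gibbs Λ bc τ = 0 := by
  rw [gibbs, le_antisymm (not_lt.1 h) (M.Z_nonneg _ _), div_zero]

/-- The finite volume Gibbs distribution depends on the boundary condition only through the
hyperbonds that meet the volume. -/
theorem weight_congr {Λ : Finset V} {ω ω' : V → F}
    (h : ∀ i ∈ M.nbhd Λ, i ∉ Λ → ω i = ω' i) : M.weight Λ ω = M.weight Λ ω' := by
  funext τ
  rw [weight_eq, weight_eq]
  refine M.boltzmann_congr fun b hb i hi => ?_
  by_cases hiΛ : i ∈ Λ
  · simp only [glue_of_mem hiΛ]
  · simp only [glue_of_notMem hiΛ, h i (subset_nbhd_of_mem_touching hb hi) hiΛ]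

theorem Z_congr {Λ : Finset V} {ω ω' : V → F}
    (h : ∀ i ∈ M.nbhd Λ, i ∉ Λ → ω i = ω' i) : M.Z Λ ω = M.Z Λ ω' := by
  simp only [Z, M.weight_congr h]

theorem gibbs_congr {Λ : Finset V} {ω ω' : V → F}
    (h : ∀ i ∈ M.nbhd Λ, i ∉ Λ → ω i = ω' i) : M.gibbs Λ ω = M.gibbs Λ ω' := by
  funext τ
  simp only [gibbs, M.weight_congr h, M.Z_congr h]

theorem Z_pos_of_forall_ne_bot {ω : V → F} (h : ∀ b ∈ M.bonds, M.φ b (fun i => ω i) ≠ ⊥)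
    (Λ : Finset V) : 0 < M.Z Λ ω := by
  refine lt_of_lt_of_le ?_ (M.weight_le_Z Λ ω fun i => ω i)
  rw [weight_eq, glue_restrict]
  refine Finset.prod_pos fun b hb => ENNReal.toReal_pos ?_ ?_
  · rw [Ne, EReal.exp_eq_zero_iff]
    exact h b (M.mem_touching.1 hb).1
  · rw [Ne, EReal.exp_eq_top_iff]
    exact M.φ_ne_top b (M.mem_touching.1 hb).1 _

/-! ### Consistency of the finite volume Gibbs measures -/

section Consistency

variable {Λ Δ : Finset V}

/-- Exchange, inside `Δ`, the spins on `Λ ⊆ Δ` with those of a second configuration. -/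
noncomputable def exchange (h : Λ ⊆ Δ) (x : (Δ → F) × (Λ → F)) : (Δ → F) × (Λ → F) :=
  (fun i => if hi : (i : V) ∈ Λ then x.2 ⟨i, hi⟩ else x.1 i, fun i => x.1 ⟨i, h i.2⟩)

theorem exchange_involutive (h : Λ ⊆ Δ) : Function.Involutive (exchange (F := F) h) := by
  rintro ⟨τ, τ'⟩
  refine Prod.ext (funext fun i => ?_) (funext fun i => ?_)
  · by_cases hi : (i : V) ∈ Λ <;> simp [exchange, hi]
  · simp [exchange]

theorem glue_glue (h : Λ ⊆ Δ) (τ : Δ → F) (τ' : Λ → F) (bc : V → F) :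
    glue Λ τ' (glue Δ τ bc) = glue Δ (exchange h (τ, τ')).1 bc := by
  funext i
  by_cases hi : i ∈ Λ
  · simp [glue, exchange, hi, h hi]
  · by_cases hi' : i ∈ Δ <;> simp [glue, exchange, hi, hi']

theorem touching_mono (h : Λ ⊆ Δ) : M.touching Λ ⊆ M.touching Δ :=
  Finset.biUnion_subset_biUnion_of_subset_left _ h

theorem boltzmann_touching (h : Λ ⊆ Δ) (ω : V → F) :
    M.boltzmann (M.touching Δ) ω =
      M.boltzmann (M.touching Δ \ M.touching Λ) ω * M.boltzmann (M.touching Λ) ω :=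
  (Finset.prod_sdiff (M.touching_mono h)).symm

/-- Detailed balance: resampling the spins in `Λ ⊆ Δ` is reversible for the Gibbs distribution
in `Δ`. -/
theorem gibbs_mul_gibbs_exchange (h : Λ ⊆ Δ) (bc : V → F) (x : (Δ → F) × (Λ → F)) :
    M.gibbs Δ bc (exchange h x).1 *
        M.gibbs Λ (glue Δ (exchange h x).1 bc) (exchange h x).2 =
      M.gibbs Δ bc x.1 * M.gibbs Λ (glue Δ x.1 bc) x.2 := by
  obtain ⟨τ, τ'⟩ := x
  have hoff : ∀ i ∉ Λ, glue Δ (exchange h (τ, τ')).1 bc i = glue Δ τ bc i := fun i hi => by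
    rw [← glue_glue, glue_of_notMem hi]
  have hZ : M.Z Λ (glue Δ (exchange h (τ, τ')).1 bc) = M.Z Λ (glue Δ τ bc) :=
    M.Z_congr fun i _ hi => hoff i hi
  have hback : glue Λ (exchange h (τ, τ')).2 (glue Δ (exchange h (τ, τ')).1 bc) =
      glue Δ τ bc := by
    rw [glue_glue h]
    exact congrArg (fun y : (Δ → F) × (Λ → F) => glue Δ y.1 bc) (exchange_involutive h (τ, τ'))
  have hC : M.boltzmann (M.touching Δ \ M.touching Λ) (glue Δ (exchange h (τ, τ')).1 bc) =
      M.boltzmann (M.touching Δ \ M.touching Λ) (glue Δ τ bc) := by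
    refine M.boltzmann_congr fun b hb i hi => hoff i fun hiΛ => ?_
    obtain ⟨hb₁, hb₂⟩ := Finset.mem_sdiff.1 hb
    exact hb₂ (M.mem_touching.2 ⟨(M.mem_touching.1 hb₁).1, i, Finset.mem_inter.2 ⟨hi, hiΛ⟩⟩)
  simp only [gibbs, hZ, weight_eq, hback, M.boltzmann_touching h, hC]
  rw [glue_glue h]
  ring

end Consistency

variable [MeasurableSpace A]

/-- The finite volume Gibbs distribution as a measure on all configurations, carried by those
that agree with the boundary condition off `Λ`. -/
noncomputable def kern (Λ : Finset V) (bc : V → F) : Measure (V → F) :=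
  ∑ τ : Λ → F, ENNReal.ofReal (M.gibbs Λ bc τ) • Measure.dirac (glue Λ τ bc)

theorem lintegral_kern (Λ : Finset V) (bc : V → F) {f : (V → F) → ENNReal} (hf : Measurable f) :
    ∫⁻ ω, f ω ∂(M.kern Λ bc) =
      ∑ τ : Λ → F, ENNReal.ofReal (M.gibbs Λ bc τ) * f (glue Λ τ bc) := by
  simp only [kern, lintegral_finsetSum_measure, lintegral_smul_measure,
    lintegral_dirac' _ hf, smul_eq_mul]

theorem kern_apply (Λ : Finset V) (bc : V → F) {E : Set (V → F)} (hE : MeasurableSet E) :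
    M.kern Λ bc E =
      ∑ τ : Λ → F, ENNReal.ofReal (M.gibbs Λ bc τ) * E.indicator (fun _ => 1) (glue Λ τ bc) := by
  rw [← lintegral_kern _ _ _ (measurable_const.indicator hE), lintegral_indicator_const hE,
    one_mul]

theorem kern_univ_of_pos {Λ : Finset V} {bc : V → F} (h : 0 < M.Z Λ bc) :
    M.kern Λ bc Set.univ = 1 := by
  rw [kern_apply _ _ _ MeasurableSet.univ]
  simp only [Set.indicator_univ, mul_one]
  rw [← ENNReal.ofReal_sum_of_nonneg fun _ _ => M.gibbs_nonneg _ _ _, M.sum_gibbs h,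
    ENNReal.ofReal_one]

theorem kern_of_not_pos {Λ : Finset V} {bc : V → F} (h : ¬ 0 < M.Z Λ bc) :
    M.kern Λ bc = 0 := by
  simp [kern, M.gibbs_eq_zero h]

theorem isProbabilityMeasure_kern {Λ : Finset V} {bc : V → F} (h : 0 < M.Z Λ bc) :
    IsProbabilityMeasure (M.kern Λ bc) := ⟨M.kern_univ_of_pos h⟩

theorem kern_apply_le_one (Λ : Finset V) (bc : V → F) (E : Set (V → F)) :
    M.kern Λ bc E ≤ 1 := by
  by_cases h : 0 < M.Z Λ bc
  · have := M.isProbabilityMeasure_kern h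
    exact prob_le_one
  · simp [M.kern_of_not_pos h]

theorem kern_prod_kern_apply (Λ : Finset V) (bc : V → F) {E : Set ((V → F) × (V → F))}
    (hE : MeasurableSet E) :
    (M.kern Λ bc).prod (M.kern Λ bc) E =
      ENNReal.ofReal (∑ ω : Λ → F, ∑ ω' : Λ → F, if (glue Λ ω bc, glue Λ ω' bc) ∈ E then
        M.gibbs Λ bc ω * M.gibbs Λ bc ω' else 0) := by
  have hfin : IsFiniteMeasure (M.kern Λ bc) :=
    ⟨(M.kern_apply_le_one Λ bc _).trans_lt ENNReal.one_lt_top⟩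
  have h0 : ∀ ω ω' : Λ → F, 0 ≤ if (glue Λ ω bc, glue Λ ω' bc) ∈ E then
      M.gibbs Λ bc ω * M.gibbs Λ bc ω' else 0 := fun ω ω' => by
    split_ifs
    · exact mul_nonneg (M.gibbs_nonneg _ _ _) (M.gibbs_nonneg _ _ _)
    · exact le_rfl
  rw [Measure.prod_apply hE, lintegral_kern _ _ _ (measurable_measure_prodMk_left hE),
    ENNReal.ofReal_sum_of_nonneg fun ω _ => Finset.sum_nonneg fun ω' _ => h0 ω ω']
  refine Finset.sum_congr rfl fun ω _ => ?_
  rw [ENNReal.ofReal_sum_of_nonneg fun ω' _ => h0 ω ω',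
    kern_apply _ _ _ (measurable_prodMk_left hE), Finset.mul_sum]
  refine Finset.sum_congr rfl fun ω' _ => ?_
  by_cases h : (glue Λ ω bc, glue Λ ω' bc) ∈ E
  · simp [h, ENNReal.ofReal_mul (M.gibbs_nonneg _ _ _)]
  · simp [h]

/-- `kern Λ ω E` depends only on those spins of `ω` that interact with `Λ` or enter in `E`. -/
theorem kern_apply_congr {Λ : Finset V} {ω ω' : V → F} {E : Set (V → F)} (hE : MeasurableSet E)
    (h : ∀ i ∈ M.nbhd Λ, i ∉ Λ → ω i = ω' i)
    (h' : ∀ τ : Λ → F, glue Λ τ ω ∈ E ↔ glue Λ τ ω' ∈ E) :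
    M.kern Λ ω E = M.kern Λ ω' E := by
  rw [kern_apply _ _ _ hE, kern_apply _ _ _ hE, M.gibbs_congr h]
  simp only [Set.indicator_apply, h']

theorem measurable_glue {Λ : Finset V} (τ : Λ → F) :
    Measurable (fun ω : V → F => glue Λ τ ω) := by
  refine measurable_pi_lambda _ fun i => ?_
  by_cases hi : i ∈ Λ
  · simp only [glue_of_mem hi]
    exact measurable_const
  · simp only [glue_of_notMem hi]
    exact measurable_pi_apply i

/-- A function of finitely many spins is measurable. -/
theorem measurable_of_dependsOn {V S β : Type*} [Finite S] [MeasurableSpace S]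
    [MeasurableSingletonClass S] [MeasurableSpace β] {f : (V → S) → β} {B : Finset V}
    (hf : DependsOn f (B : Set V)) : Measurable f := by
  by_cases hβ : Nonempty β
  · obtain ⟨g, rfl⟩ := dependsOn_iff_exists_comp.1 hf
    have : Finite (B : Set V) := B.finite_toSet
    exact (measurable_of_finite g).comp (measurable_pi_lambda _ fun i => measurable_pi_apply _)
  · have : IsEmpty β := not_nonempty_iff.1 hβ
    have : IsEmpty (V → S) := f.isEmpty
    exact measurable_of_empty f

variable [MeasurableSingletonClass A]

theorem measurable_kern (Λ : Finset V) : Measurable (M.kern Λ) := by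
  refine Measure.measurable_of_measurable_coe _ fun E hE => ?_
  simp only [kern_apply _ _ _ hE]
  refine Finset.measurable_sum _ fun τ _ => Measurable.mul ?_ ?_
  · refine ENNReal.measurable_ofReal.comp (measurable_of_dependsOn (B := M.nbhd Λ) ?_)
    intro ω ω' h
    exact congrFun (M.gibbs_congr fun i hi _ => h i hi) τ
  · exact (measurable_const.indicator hE).comp (measurable_glue τ)

theorem kern_bind_kern {Λ Δ : Finset V} (h : Λ ⊆ Δ) (bc : V → F) :
    (M.kern Δ bc).bind (M.kern Λ) = M.kern Δ bc := by
  ext E hE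
  rw [Measure.bind_apply hE (M.measurable_kern Λ).aemeasurable,
    lintegral_kern (f := fun ω => M.kern Λ ω E) _ _ _
      ((Measure.measurable_coe hE).comp (M.measurable_kern Λ)),
    kern_apply _ _ _ hE]
  set e : (V → F) → ENNReal := E.indicator fun _ => 1
  calc ∑ τ : Δ → F, ENNReal.ofReal (M.gibbs Δ bc τ) * M.kern Λ (glue Δ τ bc) E
      = ∑ x : (Δ → F) × (Λ → F), ENNReal.ofReal (M.gibbs Δ bc x.1 *
          M.gibbs Λ (glue Δ x.1 bc) x.2) * e (glue Δ (exchange h x).1 bc) := by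
        rw [Fintype.sum_prod_type]
        refine Finset.sum_congr rfl fun τ _ => ?_
        rw [kern_apply _ _ _ hE, Finset.mul_sum]
        refine Finset.sum_congr rfl fun τ' _ => ?_
        rw [glue_glue h, ENNReal.ofReal_mul (M.gibbs_nonneg _ _ _), mul_assoc]
    _ = ∑ x : (Δ → F) × (Λ → F), ENNReal.ofReal (M.gibbs Δ bc x.1 *
          M.gibbs Λ (glue Δ x.1 bc) x.2) * e (glue Δ x.1 bc) := by
        rw [← Equiv.sum_comp (exchange_involutive (F := F) h).toPerm]
        refine Finset.sum_congr rfl fun x _ => ?_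
        simp only [Function.Involutive.coe_toPerm]
        rw [M.gibbs_mul_gibbs_exchange h, exchange_involutive h x]
    _ = ∑ τ : Δ → F, ENNReal.ofReal (M.gibbs Δ bc τ) * e (glue Δ τ bc) := by
        rw [Fintype.sum_prod_type]
        refine Finset.sum_congr rfl fun τ _ => ?_
        simp only
        rw [← Finset.sum_mul, ← ENNReal.ofReal_sum_of_nonneg fun τ' _ =>
          mul_nonneg (M.gibbs_nonneg _ _ _) (M.gibbs_nonneg _ _ _), ← Finset.mul_sum]
        by_cases hZ : 0 < M.Z Λ (glue Δ τ bc)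
        · rw [M.sum_gibbs hZ, mul_one]
        -- If `Λ` cannot be filled then the configuration itself has weight zero.
        · have hw : M.boltzmann (M.touching Λ) (glue Δ τ bc) = 0 := by
            refine le_antisymm ?_ (M.boltzmann_nonneg _ _)
            have := M.weight_le_Z Λ (glue Δ τ bc) fun i => glue Δ τ bc i
            rw [weight_eq, glue_restrict] at this
            exact this.trans (not_lt.1 hZ)
          have hg : M.gibbs Δ bc τ = 0 := by
            rw [gibbs, weight_eq, M.boltzmann_touching h, hw, mul_zero, zero_div]
          simp [hg]

/-- The DLR equations say that `μ` is invariant under resampling in any finite volume. -/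
theorem isGibbs_iff {μ : Measure (V → F)} :
    M.IsGibbs μ ↔ IsProbabilityMeasure μ ∧ ∀ Λ, μ.bind (M.kern Λ) = μ := by
  refine and_congr_right fun hμ => forall_congr' fun Λ => ?_
  have hb : ∀ E, MeasurableSet E → μ.bind (M.kern Λ) E = ∫⁻ ω, ∑ τ : Λ → F,
      ENNReal.ofReal (M.gibbs Λ ω τ) * E.indicator (fun _ => 1) (glue Λ τ ω) ∂μ :=
    fun E hE => by
      rw [Measure.bind_apply hE (M.measurable_kern Λ).aemeasurable]
      simp only [kern_apply _ _ _ hE]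
  constructor
  · rintro ⟨-, h⟩
    ext E hE
    rw [hb E hE, ← h E hE]
  · intro h
    refine ⟨?_, fun E hE => by rw [← hb E hE, h]⟩
    have hm : MeasurableSet {ω : V → F | 0 < M.Z Λ ω} := by
      refine measurableSet_lt measurable_const (measurable_of_dependsOn (B := M.nbhd Λ) ?_)
      exact fun ω ω' h => M.Z_congr fun i hi _ => h i hi
    have h1 : μ.bind (M.kern Λ) Set.univ = 1 := by rw [h]; exact measure_univ
    rw [Measure.bind_apply MeasurableSet.univ (M.measurable_kern Λ).aemeasurable] at h1
    have h2 : ∀ ω, M.kern Λ ω Set.univ = {ω : V → F | 0 < M.Z Λ ω}.indicator 1 ω := by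
      intro ω
      by_cases hω : 0 < M.Z Λ ω
      · rw [M.kern_univ_of_pos hω, Set.indicator_of_mem (by exact hω), Pi.one_apply]
      · rw [M.kern_of_not_pos hω, Set.indicator_of_notMem (by exact hω)]
        rfl
    simp only [h2] at h1
    rw [lintegral_indicator_one hm] at h1
    rw [ae_iff]
    exact (prob_compl_eq_zero_iff hm).2 h1

end Interaction

end DisagreementPercolation

namespace DisagreementPercolation

open MeasureTheory Filter Topology

/-! ### Local events and limits of finite volume Gibbs measures -/

section Local

variable {V S : Type*}

/-- The event `E` for pairs of configurations depends only on the spins in `B`. -/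
def IsLocal (B : Finset V) (E : Set ((V → S) × (V → S))) : Prop :=
  ∀ ⦃x y⦄, (∀ i ∈ B, x.1 i = y.1 i ∧ x.2 i = y.2 i) → x ∈ E → y ∈ E

/-- The restriction of a pair of configurations to `B`. -/
def restrictPair (B : Finset V) (x : (V → S) × (V → S)) : B → S × S :=
  fun i => (x.1 i, x.2 i)

theorem IsLocal.preimage_image {B : Finset V} {E : Set ((V → S) × (V → S))} (h : IsLocal B E) :
    restrictPair B ⁻¹' (restrictPair B '' E) = E := by
  refine (Set.subset_preimage_image _ _).antisymm' ?_
  rintro y ⟨x, hx, hxy⟩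
  exact h (fun i hi => Prod.ext_iff.1 (congrFun hxy ⟨i, hi⟩)) hx

variable [Finite S] [MeasurableSpace S] [MeasurableSingletonClass S]

theorem IsLocal.measurableSet {B : Finset V} {E : Set ((V → S) × (V → S))} (h : IsLocal B E) :
    MeasurableSet E := by
  rw [← h.preimage_image]
  refine (measurable_pi_lambda (restrictPair B) fun i => ?_) (Set.toFinite _).measurableSet
  exact ((measurable_pi_apply _).comp measurable_fst).prodMk
    ((measurable_pi_apply _).comp measurable_snd)

/-- Every sequence of probability measures on the compact space `V → S` converges along an
ultrafilter, and then the probabilities of all local events for two independent copies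
converge. -/
theorem exists_tendsto_prod_apply [Countable V] (m : ℕ → ProbabilityMeasure (V → S)) :
    ∃ μ : ProbabilityMeasure (V → S), ∀ (B : Finset V) (E : Set ((V → S) × (V → S))),
      IsLocal B E → Tendsto (fun n => ((m n : Measure (V → S)).prod (m n)) E) (hyperfilter ℕ)
        (𝓝 ((μ : Measure (V → S)).prod μ E)) := by
  let _ : TopologicalSpace S := ⊥
  have : DiscreteTopology S := ⟨rfl⟩
  have : BorelSpace S := inferInstance
  have : BorelSpace (V → S) := inferInstance
  let U : Ultrafilter (ProbabilityMeasure (V → S)) := (hyperfilter ℕ).map m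
  have : Nonempty (ProbabilityMeasure (V → S)) := ⟨m 0⟩
  refine ⟨U.lim, fun B E hE => ?_⟩
  have hm : Tendsto m (hyperfilter ℕ) (𝓝 U.lim) := U.le_nhds_lim
  have hprod : Tendsto (fun n => (m n).prod (m n)) (hyperfilter ℕ) (𝓝 (U.lim.prod U.lim)) :=
    (ProbabilityMeasure.continuous_prod.tendsto (U.lim, U.lim)).comp (hm.prodMk_nhds hm)
  have hclopen : IsClopen E := by
    rw [← hE.preimage_image]
    refine (isClopen_discrete _).preimage (continuous_pi fun i => ?_)
    exact ((continuous_apply _).comp continuous_fst).prodMk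
      ((continuous_apply _).comp continuous_snd)
  exact ProbabilityMeasure.tendsto_measure_of_null_frontier_of_tendsto' hprod
    (by simp [hclopen.frontier_eq])

theorem exists_finset_seq_tendsto_atTop (V : Type*) [Countable V] :
    ∃ Λ : ℕ → Finset V, Tendsto Λ atTop atTop :=
  exists_seq_tendsto _

/-- The integral of a local function is a finite combination of cylinder probabilities. -/
theorem lintegral_of_dependsOn [Fintype S] (μ : Measure (V → S)) {f : (V → S) → ENNReal}
    {B : Finset V} {g : (↥(B : Set V) → S) → ENNReal} (hf : f = g ∘ (B : Set V).domRestrict) :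
    ∫⁻ ω, f ω ∂μ = ∑ x, g x * μ ((B : Set V).domRestrict ⁻¹' {x}) := by
  have hm : Measurable ((B : Set V).domRestrict : (V → S) → _) :=
    measurable_pi_lambda _ fun i => measurable_pi_apply _
  subst hf
  simp only [Function.comp]
  rw [← lintegral_map (measurable_of_finite g) hm, lintegral_fintype]
  refine Finset.sum_congr rfl fun x _ => ?_
  rw [Measure.map_apply hm (measurableSet_singleton x)]

end Local

namespace Interaction

variable {V A : Type*} [Countable V] [MeasurableSpace A] [MeasurableSingletonClass A]
  {F : Finset A} (M : Interaction V F)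

/-- Finite volume Gibbs measures in volumes growing to `V` have a limit point which is a Gibbs
measure, because the finite volume Gibbs distributions are consistent and local. -/
theorem exists_isGibbs_tendsto {Λ : ℕ → Finset V} {bc : ℕ → V → F} (hΛ : Tendsto Λ atTop atTop)
    (hZ : ∀ n, 0 < M.Z (Λ n) (bc n)) :
    ∃ μ : Measure (V → F), M.IsGibbs μ ∧
      ∀ (B : Finset V) (E : Set ((V → F) × (V → F))), IsLocal B E →
        Tendsto (fun n => (M.kern (Λ n) (bc n)).prod (M.kern (Λ n) (bc n)) E) (hyperfilter ℕ)
          (𝓝 (μ.prod μ E)) := by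
  have hp : ∀ n, IsProbabilityMeasure (M.kern (Λ n) (bc n)) := fun n =>
    M.isProbabilityMeasure_kern (hZ n)
  obtain ⟨μ, hμ⟩ := exists_tendsto_prod_apply fun n =>
    (⟨M.kern (Λ n) (bc n), hp n⟩ : ProbabilityMeasure (V → F))
  simp only [ProbabilityMeasure.coe_mk] at hμ
  refine ⟨μ, M.isGibbs_iff.2 ⟨inferInstance, fun Δ => ?_⟩, hμ⟩
  have hloc : ∀ (B : Finset V) (E : Set (V → F)),
      DependsOn (fun ω => ω ∈ E) (B : Set V) →
      Tendsto (fun n => M.kern (Λ n) (bc n) E) (hyperfilter ℕ) (𝓝 ((μ : Measure (V → F)) E)) := by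
    intro B E hE
    have := hμ B (E ×ˢ Set.univ) fun x y hxy hx => by
      refine ⟨?_, trivial⟩
      have := hE (x := x.1) (y := y.1) fun i hi => (hxy i hi).1
      exact (iff_of_eq this).1 hx.1
    simpa [Measure.prod_prod] using this
  have hcyl : ∀ E ∈ measurableCylinders (fun _ : V => F),
      (μ : Measure (V → F)) E = (μ : Measure (V → F)).bind (M.kern Δ) E := by
    intro E hE
    obtain ⟨B, T, -, rfl⟩ := (mem_measurableCylinders E).1 hE
    have hEm := MeasurableSet.of_mem_measurableCylinders hE
    have hdep : DependsOn (fun ω => ω ∈ cylinder (α := fun _ : V => F) B T) (B : Set V) := by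
      intro ω ω' h
      have : B.restrict ω = B.restrict ω' := funext fun i => h i i.2
      simp only [mem_cylinder, this]
    have hkdep : DependsOn (fun ω => M.kern Δ ω (cylinder B T))
        ((M.nbhd Δ ∪ B : Finset V) : Set V) := by
      intro ω ω' h
      refine M.kern_apply_congr hEm
        (fun i hi _ => h i (Finset.mem_coe.2 (Finset.mem_union_left _ hi))) fun τ => ?_
      refine iff_of_eq (hdep fun i hi => ?_)
      by_cases hiΔ : i ∈ Δ
      · simp only [glue_of_mem hiΔ]
      · simp only [glue_of_notMem hiΔ]
        exact h i (Finset.mem_coe.2 (Finset.mem_union_right _ hi))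
    obtain ⟨g, hg⟩ := dependsOn_iff_exists_comp.1 hkdep
    -- Truncation makes the coefficients finite also on local configurations without extension.
    have hg' : (fun ω => M.kern Δ ω (cylinder B T)) =
        (fun x => min (g x) 1) ∘ ((M.nbhd Δ ∪ B : Finset V) : Set V).domRestrict := by
      funext ω
      have := congrFun hg ω
      simp only [Function.comp] at this ⊢
      rw [← this, min_eq_left (M.kern_apply_le_one _ _ _)]
    rw [Measure.bind_apply hEm (M.measurable_kern Δ).aemeasurable]
    have hlim : Tendsto (fun n => ∫⁻ ω, M.kern Δ ω (cylinder B T) ∂(M.kern (Λ n) (bc n)))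
        (hyperfilter ℕ) (𝓝 (∫⁻ ω, M.kern Δ ω (cylinder B T) ∂(μ : Measure (V → F)))) := by
      simp only [lintegral_of_dependsOn _ hg']
      refine tendsto_finsetSum _ fun x _ => ENNReal.Tendsto.const_mul
        (hloc (M.nbhd Δ ∪ B) _ ?_) (Or.inr ((min_le_right _ _).trans_lt ENNReal.one_lt_top).ne)
      intro ω ω' h
      have : ((M.nbhd Δ ∪ B : Finset V) : Set V).domRestrict ω =
          ((M.nbhd Δ ∪ B : Finset V) : Set V).domRestrict ω' := funext fun i => h i i.2
      simp only [Set.mem_preimage, this]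
    refine tendsto_nhds_unique (hloc B _ hdep) (hlim.congr' ?_)
    have hev : ∀ᶠ n in (hyperfilter ℕ : Filter ℕ), Δ ⊆ Λ n :=
      (Nat.hyperfilter_le_atTop) (hΛ.eventually_ge_atTop Δ)
    filter_upwards [hev] with n hn
    rw [← Measure.bind_apply hEm (M.measurable_kern Δ).aemeasurable, M.kern_bind_kern hn]
  exact (ext_of_generate_finite _ generateFrom_measurableCylinders.symm
    isPiSystem_measurableCylinders hcyl (hcyl _ (univ_mem_measurableCylinders _))).symm

end Interaction

end DisagreementPercolation

namespace DisagreementPercolation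

open MeasureTheory Filter Topology

/-! ### Long paths in a random region -/

/-- The sites at which the spins of the two configurations are related by `r`. -/
def pairRegion {V S : Type*} (r : S → S → Prop) (x : (V → S) × (V → S)) : Set V :=
  {i | r (x.1 i) (x.2 i)}

namespace Interaction

variable {V A : Type*} {F : Finset A} (M : Interaction V F)

/-- The event that a self-avoiding path with `k` steps in the region given by `r` starts in `S`. -/
def pathEvent (r : F → F → Prop) (S : Finset V) (k : ℕ) : Set ((V → F) × (V → F)) :=
  {x | HasPath M.graph (pairRegion r x) S k}

theorem isLocal_pathEvent (r : F → F → Prop) (S : Finset V) (k : ℕ) :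
    IsLocal (M.nbhd^[k] S) (M.pathEvent r S k) := by
  intro x y hxy hx
  refine hasPath_congr (fun v hv hvx => ?_) hx
  show r (y.1 v) (y.2 v)
  rw [← (hxy v hv).1, ← (hxy v hv).2]
  exact hvx

theorem antitone_pathEvent (r : F → F → Prop) (S : Finset V) :
    Antitone (M.pathEvent r S) :=
  fun _ _ hjk _ hx => HasPath.mono_length hjk hx

section Measure

variable [MeasurableSpace A] [MeasurableSingletonClass A]

theorem measurableSet_pathEvent (r : F → F → Prop) (S : Finset V) (k : ℕ) :
    MeasurableSet (M.pathEvent r S k) := (M.isLocal_pathEvent r S k).measurableSet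

/-- If there is almost surely no infinite path then long paths are unlikely. -/
theorem tendsto_measure_pathEvent {P : Measure ((V → F) × (V → F))} [IsFiniteMeasure P]
    {r : F → F → Prop} (h : ∀ᵐ x ∂P, ¬ HasInfinitePath M.graph (pairRegion r x))
    (S : Finset V) : Tendsto (fun k => P (M.pathEvent r S k)) atTop (𝓝 0) := by
  have h0 : P (⋂ k, M.pathEvent r S k) = 0 := by
    refine measure_mono_null (fun x hx => ?_) (ae_iff.1 h)
    exact not_not.2 (hasInfinitePath_of_forall_hasPath M.finite_neighborSet S.finite_toSet
      fun k => Set.mem_iInter.1 hx k)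
  rw [← h0]
  exact tendsto_measure_iInter_atTop
    (fun k => (M.measurableSet_pathEvent r S k).nullMeasurableSet)
    (M.antitone_pathEvent r S) ⟨0, measure_ne_top _ _⟩

end Measure

/-! ### Uniqueness of the Gibbs measure -/

variable {M}

variable (M) in
/-- The event that the region of `Λ` sheltered from disagreement is exactly `G`. -/
def shelterEvent (Λ G : Finset V) : Set ((V → F) × (V → F)) :=
  {x | M.sheltered Λ (pairRegion (· ≠ ·) x) = G}

theorem isLocal_shelterEvent (Λ G : Finset V) : IsLocal Λ (M.shelterEvent Λ G) := by
  intro x y hxy hx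
  refine (sheltered_congr fun v hv _ => ?_).trans hx
  show x.1 v ≠ x.2 v ↔ y.1 v ≠ y.2 v
  rw [(hxy v hv).1, (hxy v hv).2]

/-- Whether the sheltered region is `G` does not depend on the spins in `G`. -/
theorem shelterEvent_of_eq_off {Λ G : Finset V} {x y : (V → F) × (V → F)}
    (hxy : ∀ i ∉ G, x.1 i = y.1 i ∧ x.2 i = y.2 i) (hx : x ∈ M.shelterEvent Λ G) :
    y ∈ M.shelterEvent Λ G := by
  have hx' : M.sheltered Λ (pairRegion (· ≠ ·) x) = G := hx
  refine (sheltered_congr fun v _ hv => ?_).trans hx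
  rw [hx'] at hv
  show x.1 v ≠ x.2 v ↔ y.1 v ≠ y.2 v
  rw [(hxy v hv).1, (hxy v hv).2]

variable [MeasurableSpace A]

/-- The DLR equation for the product of an event `T` outside `G` and an arbitrary event `E`. -/
theorem IsGibbs.measure_inter {μ : Measure (V → F)} (hμ : M.IsGibbs μ) {G : Finset V}
    {T E : Set (V → F)} (hT : MeasurableSet T) (hE : MeasurableSet E)
    (hTG : ∀ (τ : G → F) (ω : V → F), glue G τ ω ∈ T ↔ ω ∈ T) :
    μ (T ∩ E) = ∫⁻ ω, T.indicator (fun ω => M.kern G ω E) ω ∂μ := by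
  rw [(hμ.2 G).2 _ (hT.inter hE)]
  refine lintegral_congr fun ω => ?_
  by_cases hω : ω ∈ T
  · rw [Set.indicator_of_mem hω, M.kern_apply _ _ hE]
    simp only [Set.indicator_apply, Set.mem_inter_iff, hTG, hω, true_and]
  · rw [Set.indicator_of_notMem hω]
    simp only [Set.indicator_apply, Set.mem_inter_iff, hTG, hω, false_and, if_false, mul_zero,
      Finset.sum_const_zero]

variable [MeasurableSingletonClass A]

/-- In an event that depends only on the spins of the two copies outside `G`, the second copy
may be resampled in `G`. -/
theorem IsGibbs.prod_inter_snd {μ μ' : Measure (V → F)} [SFinite μ] [SFinite μ']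
    (hμ' : M.IsGibbs μ') {G : Finset V} {T : Set ((V → F) × (V → F))} {E : Set (V → F)}
    (hT : MeasurableSet T) (hE : MeasurableSet E)
    (hTG : ∀ (τ : G → F) (ω ω' : V → F), (ω, glue G τ ω') ∈ T ↔ (ω, ω') ∈ T) :
    μ.prod μ' (T ∩ Prod.snd ⁻¹' E) =
      ∫⁻ x, T.indicator (fun x => M.kern G x.2 E) x ∂(μ.prod μ') := by
  have hk : Measurable fun x : (V → F) × (V → F) => M.kern G x.2 E :=
    (Measure.measurable_coe hE).comp ((M.measurable_kern G).comp measurable_snd)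
  rw [Measure.prod_apply (hT.inter (measurable_snd hE)),
    lintegral_prod _ (hk.indicator hT).aemeasurable]
  refine lintegral_congr fun ω => ?_
  exact hμ'.measure_inter (measurable_prodMk_left hT) hE fun τ ω' => hTG τ ω ω'

/-- The counterpart of `IsGibbs.prod_inter_snd` for the first copy. -/
theorem IsGibbs.prod_inter_fst {μ μ' : Measure (V → F)} [SFinite μ] [SFinite μ']
    (hμ : M.IsGibbs μ) {G : Finset V} {T : Set ((V → F) × (V → F))} {E : Set (V → F)}
    (hT : MeasurableSet T) (hE : MeasurableSet E)
    (hTG : ∀ (τ : G → F) (ω ω' : V → F), (glue G τ ω, ω') ∈ T ↔ (ω, ω') ∈ T) :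
    μ.prod μ' (T ∩ Prod.fst ⁻¹' E) =
      ∫⁻ x, T.indicator (fun x => M.kern G x.1 E) x ∂(μ.prod μ') := by
  have hk : Measurable fun x : (V → F) × (V → F) => M.kern G x.1 E :=
    (Measure.measurable_coe hE).comp ((M.measurable_kern G).comp measurable_fst)
  rw [Measure.prod_apply_symm (hT.inter (measurable_fst hE)),
    lintegral_prod_symm _ (hk.indicator hT).aemeasurable]
  refine lintegral_congr fun ω' => ?_
  exact hμ.measure_inter (measurable_prodMk_right hT) hE fun τ ω => hTG τ ω ω'

/-- On the event that the sheltered region is `G`, the two copies see the same boundary condition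
for `G`, so that an event inside `G` is equally likely for both. -/
theorem prod_shelterEvent_inter {μ μ' : Measure (V → F)} (hμ : M.IsGibbs μ)
    (hμ' : M.IsGibbs μ') (Λ : Finset V) {B G : Finset V} (hBG : B ⊆ G) {E : Set (V → F)}
    (hE : MeasurableSet E) (hEB : DependsOn (fun ω => ω ∈ E) (B : Set V)) :
    μ.prod μ' (M.shelterEvent Λ G ∩ Prod.fst ⁻¹' E) =
      μ.prod μ' (M.shelterEvent Λ G ∩ Prod.snd ⁻¹' E) := by
  have := hμ.1
  have := hμ'.1
  have hT := (isLocal_shelterEvent (M := M) Λ G).measurableSet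
  have hoff : ∀ (τ : G → F) (ω : V → F), ∀ i ∉ G, glue G τ ω i = ω i :=
    fun τ ω i hi => glue_of_notMem hi
  rw [hμ.prod_inter_fst (G := G) hT hE, hμ'.prod_inter_snd (G := G) hT hE]
  · refine lintegral_congr fun x => ?_
    by_cases hx : x ∈ M.shelterEvent Λ G
    · rw [Set.indicator_of_mem hx, Set.indicator_of_mem hx]
      have hx' : M.sheltered Λ (pairRegion (· ≠ ·) x) = G := hx
      refine M.kern_apply_congr hE (fun i hi hiG => ?_) fun τ => iff_of_eq (hEB fun i hi => ?_)
      · rw [← hx'] at hi hiG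
        exact not_not.1 (notMem_of_mem_nbhd_sheltered hi hiG)
      · simp only [glue_of_mem (hBG hi)]
    · rw [Set.indicator_of_notMem hx, Set.indicator_of_notMem hx]
  · exact fun τ ω ω' => ⟨shelterEvent_of_eq_off fun i hi => ⟨rfl, hoff τ ω' i hi⟩,
      shelterEvent_of_eq_off fun i hi => ⟨rfl, (hoff τ ω' i hi).symm⟩⟩
  · exact fun τ ω ω' => ⟨shelterEvent_of_eq_off fun i hi => ⟨hoff τ ω i hi, rfl⟩,
      shelterEvent_of_eq_off fun i hi => ⟨(hoff τ ω i hi).symm, rfl⟩⟩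

/-- Two Gibbs measures differ on an event in `B` by at most the probability that a long path of
disagreement starts near `B`. -/
theorem measure_le_add_pathEvent {μ μ' : Measure (V → F)} (hμ : M.IsGibbs μ)
    (hμ' : M.IsGibbs μ') {B : Finset V} {E : Set (V → F)} (hE : MeasurableSet E)
    (hEB : DependsOn (fun ω => ω ∈ E) (B : Set V)) (k : ℕ) :
    μ E ≤ μ' E + μ.prod μ' (M.pathEvent (· ≠ ·) (M.nbhd B) k) := by
  have := hμ.1
  have := hμ'.1
  set Λ := M.nbhd^[k + 2] B
  set I : Finset (Finset V) := Λ.powerset.filter fun G => B ⊆ G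
  have hT : ∀ G, MeasurableSet (M.shelterEvent Λ G) := fun G =>
    (isLocal_shelterEvent (M := M) Λ G).measurableSet
  have hdisj : ∀ E' : Set ((V → F) × (V → F)), (I : Set (Finset V)).PairwiseDisjoint
      fun G => M.shelterEvent Λ G ∩ E' := by
    intro E' G _ G' _ hne
    refine Set.disjoint_left.2 fun x hx hx' => hne ?_
    have h₁ : M.sheltered Λ (pairRegion (· ≠ ·) x) = G := hx.1
    have h₂ : M.sheltered Λ (pairRegion (· ≠ ·) x) = G' := hx'.1
    exact h₁.symm.trans h₂
  have hcover : Prod.fst ⁻¹' E ⊆ (⋃ G ∈ I, M.shelterEvent Λ G ∩ Prod.fst ⁻¹' E) ∪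
      M.pathEvent (· ≠ ·) (M.nbhd B) k := by
    intro x hx
    by_cases hB : B ⊆ M.sheltered Λ (pairRegion (· ≠ ·) x)
    · refine Or.inl (Set.mem_iUnion₂.2 ⟨_, Finset.mem_filter.2
        ⟨Finset.mem_powerset.2 (sheltered_subset Λ _), hB⟩, rfl, hx⟩)
    · exact Or.inr (hasPath_of_not_subset_sheltered hB)
  calc μ E = μ.prod μ' (Prod.fst ⁻¹' E) := by
        rw [← Set.prod_univ, Measure.prod_prod, measure_univ, mul_one]
    _ ≤ μ.prod μ' (⋃ G ∈ I, M.shelterEvent Λ G ∩ Prod.fst ⁻¹' E) +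
          μ.prod μ' (M.pathEvent (· ≠ ·) (M.nbhd B) k) :=
        (measure_mono hcover).trans (measure_union_le _ _)
    _ = μ.prod μ' (⋃ G ∈ I, M.shelterEvent Λ G ∩ Prod.snd ⁻¹' E) +
          μ.prod μ' (M.pathEvent (· ≠ ·) (M.nbhd B) k) := by
        rw [measure_biUnion_finset (hdisj _) fun G _ => (hT G).inter (measurable_fst hE),
          measure_biUnion_finset (hdisj _) fun G _ => (hT G).inter (measurable_snd hE)]
        congr 1
        exact Finset.sum_congr rfl fun G hG =>
          prod_shelterEvent_inter hμ hμ' Λ (Finset.mem_filter.1 hG).2 hE hEB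
    _ ≤ μ.prod μ' (Prod.snd ⁻¹' E) + μ.prod μ' (M.pathEvent (· ≠ ·) (M.nbhd B) k) := by
        gcongr
        exact Set.iUnion₂_subset fun G _ => Set.inter_subset_right
    _ = μ' E + μ.prod μ' (M.pathEvent (· ≠ ·) (M.nbhd B) k) := by
        rw [← Set.univ_prod, Measure.prod_prod, measure_univ, one_mul]

/-- Absence of disagreement percolation forces two Gibbs measures to coincide. -/
theorem IsGibbs.eq_of_forall_not_hasInfinitePath
    (h : ∀ μ μ' : Measure (V → F), M.IsGibbs μ → M.IsGibbs μ' →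
      ∀ᵐ x ∂(μ.prod μ'), ¬ HasInfinitePath M.graph (pairRegion (· ≠ ·) x))
    {μ μ' : Measure (V → F)} (hμ : M.IsGibbs μ) (hμ' : M.IsGibbs μ') : μ = μ' := by
  have hle : ∀ ν ν' : Measure (V → F), M.IsGibbs ν → M.IsGibbs ν' →
      ∀ E ∈ measurableCylinders (fun _ : V => F), ν E ≤ ν' E := by
    intro ν ν' hν hν' E hE
    have := hν.1
    have := hν'.1
    obtain ⟨B, T, -, rfl⟩ := (mem_measurableCylinders E).1 hE
    have hdep : DependsOn (fun ω => ω ∈ cylinder (α := fun _ : V => F) B T) (B : Set V) := by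
      intro ω ω' h
      have : B.restrict ω = B.restrict ω' := funext fun i => h i i.2
      simp only [mem_cylinder, this]
    have hlim := (M.tendsto_measure_pathEvent (h ν ν' hν hν') (M.nbhd B)).const_add
      (ν' (cylinder B T))
    rw [add_zero] at hlim
    exact ge_of_tendsto' hlim fun k => measure_le_add_pathEvent hν hν'
      (MeasurableSet.of_mem_measurableCylinders hE) hdep k
  have := hμ.1
  exact ext_of_generate_finite _ generateFrom_measurableCylinders.symm
    isPiSystem_measurableCylinders
    (fun E hE => (hle μ μ' hμ hμ' E hE).antisymm (hle μ' μ hμ' hμ E hE))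
    (by rw [measure_univ, hμ'.1.measure_univ])

theorem existsUnique_isGibbs [Countable V]
    (hadm : ∃ ω : V → F, ∀ b ∈ M.bonds, M.φ b (fun i => ω i) ≠ ⊥)
    (h : ∀ μ μ' : Measure (V → F), M.IsGibbs μ → M.IsGibbs μ' →
      ∀ᵐ x ∂(μ.prod μ'), ¬ HasInfinitePath M.graph (pairRegion (· ≠ ·) x)) :
    ∃! μ : Measure (V → F), M.IsGibbs μ := by
  obtain ⟨ω, hω⟩ := hadm
  obtain ⟨Λ, hΛ⟩ := exists_finset_seq_tendsto_atTop V
  obtain ⟨μ, hμ, -⟩ := M.exists_isGibbs_tendsto (bc := fun _ => ω) hΛ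
    fun n => M.Z_pos_of_forall_ne_bot hω (Λ n)
  exact ⟨μ, hμ, fun μ' hμ' => hμ'.eq_of_forall_not_hasInfinitePath h hμ⟩

end Interaction

end DisagreementPercolation

namespace DisagreementPercolation

open MeasureTheory Filter Topology

/-! ### Active connectivity in the overlap representation -/

section Fiber

variable {A : Type*} [AddCommGroup A] {F : Finset A}

theorem one_lt_card_fiber {a b : F} (h : a ≠ b) : 1 < (fiber F ((a : A) + b)).card := by
  refine Finset.one_lt_card.2 ⟨a, ?_, b, ?_, fun hab => h (Subtype.ext hab)⟩
  · exact Finset.mem_filter.2 ⟨a.2, b, b.2, rfl⟩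
  · exact Finset.mem_filter.2 ⟨b.2, a, a.2, add_comm _ _⟩

theorem disagreement_subset_nonOverlap {V : Type*} (ω ω' : V → F) :
    disagreement ω ω' ⊆ nonOverlap ω ω' :=
  fun _ hi => (one_lt_card_fiber hi).ne'

theorem nonOverlap_eq_disagreement {V : Type*}
    (hF : ∀ a ∈ F, ∀ b ∈ F, ∀ c ∈ F, b + c = a + a → b = a) (ω ω' : V → F) :
    nonOverlap ω ω' = disagreement ω ω' := by
  refine Set.Subset.antisymm (fun i hi hω => hi ?_) (disagreement_subset_nonOverlap ω ω')
  refine Finset.card_eq_one.2 ⟨ω i, Finset.eq_singleton_iff_unique_mem.2 ⟨?_, ?_⟩⟩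
  · exact Finset.mem_filter.2 ⟨(ω i).2, ω' i, (ω' i).2, rfl⟩
  · intro b hb
    obtain ⟨hb, c, hc, hbc⟩ := Finset.mem_filter.1 hb
    rw [← hω] at hbc
    exact hF _ (ω i).2 b hb c hc hbc

end Fiber

namespace Interaction

variable {V A : Type*} [AddCommGroup A] {F : Finset A} (M : Interaction V F)

variable {M} in
/-- Successive hyperbonds of an active chain share a site of the non-overlap region, so a chain
from `Λ₀` to a remote boundary contains a long path of non-overlap. -/
theorem ActConnected.hasPath {Λ Λ₀ : Finset V} {σ : Λ → A} {η : M.HyperConfig Λ} {k : ℕ}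
    (h : M.ActConnected σ (Λ₀ : Set V) (M.boundary (M.nbhd^[k + 3] Λ₀)) η) {D : Set V}
    (hD : ∀ i : Λ, (fiber F (σ i)).card ≠ 1 → (i : V) ∈ D) :
    HasPath M.graph D (M.nbhd Λ₀) k := by
  obtain ⟨b, c, -, -, ⟨u, hub, hu⟩, ⟨v, hvc, hv⟩, hbc⟩ := h
  rw [Function.iterate_succ_apply'] at hv
  have hv' := notMem_of_mem_boundary_nbhd hv
  have hbond : ∀ d : ↥(M.touching Λ), (d : Finset V) ∈ M.bonds :=
    fun d => (M.mem_touching.1 d.2).1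
  have key : c = b ∨ ∃ i ∈ M.nbhd Λ₀, ∃ j ∈ (c : Finset V), j ∈ D ∧
      (edgesIn M.graph D).Reachable i j := by
    clear hv hv' hvc
    induction hbc with
    | refl => exact Or.inl rfl
    | @tail c d _ hcd ih =>
      obtain ⟨-, -, l, hlc, hld, hl⟩ := hcd
      right
      rcases ih with rfl | ⟨i, hi, j, hj, hjD, hij⟩
      · exact ⟨l, mem_nbhd.2 (Or.inr ⟨c, hbond c, hlc, u, hu, hub⟩), l, hld, hD l hl, .refl _⟩
      · refine ⟨i, hi, l, hld, hD l hl, ?_⟩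
        by_cases hjl : j = l
        · rwa [← hjl]
        · exact hij.trans (SimpleGraph.Adj.reachable
            ⟨⟨hjl, c, hbond c, hj, hlc⟩, hjD, hD l hl⟩)
  rcases key with rfl | ⟨i, hi, j, hj, -, hij⟩
  · refine absurd ?_ hv'
    exact monotone_iterate_nbhd Λ₀ (show 1 ≤ k + 2 by omega)
      (mem_nbhd.2 (Or.inr ⟨c, hbond c, hvc, u, hu, hub⟩))
  · refine hasPath_of_reachable hi hij fun hjk => hv' ?_
    rw [← Function.iterate_succ_apply] at hjk
    rw [Function.iterate_succ_apply']
    exact mem_nbhd.2 (Or.inr ⟨c, hbond c, hvc, j, hjk, hj⟩)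

theorem rcrProb_eq_zero {Λ : Finset V} (σ : Λ → A) (ν : M.HyperConfig Λ → ℝ)
    {C : M.HyperConfig Λ → Prop} (h : ∀ η, ¬ C η) : M.rcrProb σ ν C = 0 := by
  simp [rcrProb, h]

theorem sum_overlapDist (Λ : Finset V) (bc : V → F) (Q : (Λ → A) → Prop) :
    (∑ σ ∈ overlapConfigs F Λ, if Q σ then M.overlapDist Λ bc σ else 0) =
      ∑ ω : Λ → F, ∑ ω' : Λ → F, if Q fun i => (ω i : A) + ω' i then
        M.gibbs Λ bc ω * M.gibbs Λ bc ω' else 0 := by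
  have h₁ : ∀ σ, (if Q σ then M.overlapDist Λ bc σ else 0) =
      ∑ ω : Λ → F, ∑ ω' : Λ → F, if (fun i => (ω i : A) + ω' i) = σ then
        (if Q σ then M.gibbs Λ bc ω * M.gibbs Λ bc ω' else 0) else 0 := by
    intro σ
    by_cases hσ : Q σ <;> simp [hσ, overlapDist, funext_iff]
  simp only [h₁]
  rw [Finset.sum_comm]
  refine Finset.sum_congr rfl fun ω _ => ?_
  rw [Finset.sum_comm]
  refine Finset.sum_congr rfl fun ω' _ => ?_
  rw [Finset.sum_ite_eq, if_pos]
  refine Fintype.mem_piFinset.2 fun i => Finset.mem_image.2 ⟨(ω i, ω' i), ?_, rfl⟩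
  exact Finset.mem_product.2 ⟨(ω i).2, (ω' i).2⟩

variable [MeasurableSpace A]

/-- If an overlap configuration with the property `Q` is not typical, then the event `E`, which
holds whenever the sum of the two copies violates `Q`, is not negligible. -/
theorem lt_prod_kern_of_sum_overlapDist_lt {Λ : Finset V} {bc : V → F} (hZ : 0 < M.Z Λ bc)
    {Q : (Λ → A) → Prop} {E : Set ((V → F) × (V → F))} (hE : MeasurableSet E)
    (hQE : ∀ ω ω' : Λ → F, ¬ Q (fun i => (ω i : A) + ω' i) →
      (glue Λ ω bc, glue Λ ω' bc) ∈ E) {ε : ℝ} (hε : 0 < ε)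
    (h : (∑ σ ∈ overlapConfigs F Λ, if Q σ then M.overlapDist Λ bc σ else 0) < 1 - ε) :
    ENNReal.ofReal ε < (M.kern Λ bc).prod (M.kern Λ bc) E := by
  rw [kern_prod_kern_apply _ _ _ hE]
  rw [sum_overlapDist] at h
  have h1 : (1 : ℝ) = ∑ ω : Λ → F, ∑ ω' : Λ → F, M.gibbs Λ bc ω * M.gibbs Λ bc ω' := by
    rw [← Finset.sum_mul_sum, M.sum_gibbs hZ, mul_one]
  have h2 : (∑ ω : Λ → F, ∑ ω' : Λ → F, M.gibbs Λ bc ω * M.gibbs Λ bc ω') ≤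
      (∑ ω : Λ → F, ∑ ω' : Λ → F, if Q fun i => (ω i : A) + ω' i then
        M.gibbs Λ bc ω * M.gibbs Λ bc ω' else 0) +
      ∑ ω : Λ → F, ∑ ω' : Λ → F, if (glue Λ ω bc, glue Λ ω' bc) ∈ E then
        M.gibbs Λ bc ω * M.gibbs Λ bc ω' else 0 := by
    simp only [← Finset.sum_add_distrib]
    refine Finset.sum_le_sum fun ω _ => Finset.sum_le_sum fun ω' _ => ?_
    have h0 := mul_nonneg (M.gibbs_nonneg Λ bc ω) (M.gibbs_nonneg Λ bc ω')
    by_cases hQ : Q fun i => (ω i : A) + ω' i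
    · rw [if_pos hQ]
      split_ifs <;> linarith
    · rw [if_neg hQ, if_pos (hQE ω ω' hQ), zero_add]
  rw [ENNReal.ofReal_lt_ofReal_iff] <;> linarith

variable [MeasurableSingletonClass A]

variable {M} in
/-- Absence of non-overlap percolation under products of Gibbs measures implies that active
connectivity vanishes: otherwise the finite volume measures along which it fails to vanish would
have a limit point charging the infinite paths of non-overlap. -/
theorem conditionBForAll_of_forall_not_hasInfinitePath [Countable V]
    (h : ∀ μ μ' : Measure (V → F), M.IsGibbs μ → M.IsGibbs μ' →
      ∀ᵐ x ∂(μ.prod μ'), ¬ HasInfinitePath M.graph (nonOverlap x.1 x.2)) :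
    M.ConditionBForAll := by
  intro Λ bc ν _ hZ _ Λ₀ ε hε
  by_contra! hcon
  let r : F → F → Prop := fun a b => (fiber F ((a : A) + b)).card ≠ 1
  obtain ⟨L, hL⟩ := exists_finset_seq_tendsto_atTop V
  have hbad : ∀ k, ∃ n, L k ⊆ Λ n ∧ ENNReal.ofReal ε <
      (M.kern (Λ n) (bc n)).prod (M.kern (Λ n) (bc n)) (M.pathEvent r (M.nbhd Λ₀) k) := by
    intro k
    obtain ⟨n, hn, hlt⟩ := hcon (M.nbhd^[k + 3] Λ₀) (M.nbhd^[k + 3] Λ₀ ∪ L k)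
      (monotone_iterate_nbhd Λ₀ (Nat.zero_le (k + 3))) Finset.subset_union_left
    refine ⟨n, Finset.subset_union_right.trans hn,
      M.lt_prod_kern_of_sum_overlapDist_lt (hZ n) (M.measurableSet_pathEvent r _ k) ?_ hε hlt⟩
    intro ω ω' hQ
    have hex : ∃ η, M.ActConnected (fun i => (ω i : A) + ω' i) (Λ₀ : Set V)
        (M.boundary (M.nbhd^[k + 3] Λ₀)) η := by
      by_contra! hno
      exact hQ (by rw [M.rcrProb_eq_zero _ _ hno]; exact hε.le)
    obtain ⟨η, hη⟩ := hex
    refine hη.hasPath fun i hi => ?_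
    show (fiber F (((glue (Λ n) ω (bc n) i : F) : A) + (glue (Λ n) ω' (bc n) i : F))).card ≠ 1
    rwa [glue_of_mem i.2, glue_of_mem i.2]
  choose n hn hlt using hbad
  obtain ⟨μ, hμ, hlim⟩ := M.exists_isGibbs_tendsto (Λ := fun k => Λ (n k))
    (bc := fun k => bc (n k)) (tendsto_atTop_mono hn hL) fun k => hZ (n k)
  have hμp := hμ.1
  have hge : ∀ j, ENNReal.ofReal ε ≤ μ.prod μ (M.pathEvent r (M.nbhd Λ₀) j) := by
    intro j
    refine ge_of_tendsto (hlim _ _ (M.isLocal_pathEvent r _ j)) ?_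
    have hev : ∀ᶠ k in (hyperfilter ℕ : Filter ℕ), j ≤ k :=
      Nat.hyperfilter_le_atTop (eventually_ge_atTop j)
    filter_upwards [hev] with k hk
    exact (hlt k).le.trans (measure_mono (M.antitone_pathEvent r _ hk))
  have hzero := M.tendsto_measure_pathEvent (r := r) (h μ μ hμ hμ) (M.nbhd Λ₀)
  exact absurd (ge_of_tendsto' hzero hge) (not_le.2 (ENNReal.ofReal_pos.2 hε))

end Interaction

end DisagreementPercolation

theorem mainTheorem7 {V A : Type*} [Countable V] [AddCommGroup A] [MeasurableSpace A]
    [MeasurableSingletonClass A] (F : Finset A)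
    (M : DisagreementPercolation.Interaction V F)
    (hadm : ∃ ω : V → F, ∀ b ∈ M.bonds, M.φ b (fun i => ω i) ≠ ⊥) :
    ((∀ μ μ' : MeasureTheory.Measure (V → F), M.IsGibbs μ → M.IsGibbs μ' →
        ∀ᵐ x ∂(μ.prod μ'), ¬ DisagreementPercolation.HasInfinitePath M.graph
          (DisagreementPercolation.nonOverlap x.1 x.2)) →
      M.ConditionBForAll ∧ ∃! μ : MeasureTheory.Measure (V → F), M.IsGibbs μ) ∧
    ((∀ μ μ' : MeasureTheory.Measure (V → F), M.IsGibbs μ → M.IsGibbs μ' →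
        ∀ᵐ x ∂(μ.prod μ'), ¬ DisagreementPercolation.HasInfinitePath M.graph
          (DisagreementPercolation.disagreement x.1 x.2)) →
      (∃! μ : MeasureTheory.Measure (V → F), M.IsGibbs μ) ∧
      ((∀ a ∈ F, ∀ b ∈ F, ∀ c ∈ F, b + c = a + a → b = a) → M.ConditionBForAll)) := by
  obtain h := fun hnp =>
    DisagreementPercolation.Interaction.existsUnique_isGibbs (M := M) hadm hnp
  refine ⟨fun hno => ⟨?_, h fun μ μ' hμ hμ' => ?_⟩, fun hdis => ⟨h hdis, fun hF => ?_⟩⟩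
  · exact DisagreementPercolation.Interaction.conditionBForAll_of_forall_not_hasInfinitePath hno
  · filter_upwards [hno μ μ' hμ hμ'] with x hx hp
    exact hx (hp.mono (DisagreementPercolation.disagreement_subset_nonOverlap x.1 x.2))
  · refine DisagreementPercolation.Interaction.conditionBForAll_of_forall_not_hasInfinitePath ?_
    intro μ μ' hμ hμ'
    simp only [DisagreementPercolation.nonOverlap_eq_disagreement hF]
    exact hdis μ μ' hμ hμ'
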